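/- Let $n\ge 1$, let $M$ be a smooth manifold and let $\omega\in\Omega^{n+1}(M)$ be closed. A vector field $v_\alpha$ is a Hamiltonian vector field of $\alpha\in\Omega^{n-1}(M)$ if $d\alpha=-\iota_{v_\alpha}\omega$; $\alpha$ is Hamiltonian if such a $v_\alpha$ exists. Let $\mathfrak g$ be a real Lie algebra, let $\partial\colon\Lambda^k\mathfrak g\to\Lambda^{k-1}\mathfrak g$, $$\partial(x_1\wedge\dots\wedge x_k)=\sum_{1\le i<j\le k}(-1)^{i+j}[x_i,x_j]\wedge x_1\wedge\dots\wedge\hat x_i\wedge\dots\wedge\hat x_j\wedge\dots\wedge x_k ,$$ be the Lie algebra homology differential, and let $Z_k(\mathfrak g)=\ker(\partial|_{\Lambda^k\mathfrak g})$. Let $v\colon\mathfrak g\to\mathfrak X(M)$, $x\mapsto v_x$, be a homomorphism of Lie algebras with $\mathcal L_{v_x}\omega=0$ for all $x\in\mathfrak g$. A (homotopy) co-momentum map for $v$ is a family of linear maps $f_k\colon\Lambda^k\mathfrak g\to\Omega^{n-k}(M)$, $1\le k\le n$, such that $f_1$ takes values in Hamiltonian forms, $d(f_1(x))=-\iota_{v_x}\omega$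 for all $x\in\mathfrak g$, and, with $f_0=0$, $f_{n+1}=0$ and $\varsigma(k)=-(-1)^{k(k+1)/2}$, $$-f_{k-1}(\partial p)=d f_k(p)+\varsigma(k)\,\iota_{v_{x_k}}\cdots\iota_{v_{x_1}}\omega\qquad\text{for } p=x_1\wedge\dots\wedge x_k,\quad 1\le k\le n+1 .$$ (1) Let $H\in\Omega^{n-1}(M)$ be Hamiltonian, let the action $v$ be locally $H$-preserving, i.e. $\mathcal L_{v_x}H$ is closed for all $x\in\mathfrak g$, and let $(f_k)$ be a co-momentum map for $v$. Then for every $1\le k\le n$, every $p\in Z_k(\mathfrak g)$ and every Hamiltonian vector field $v_H$ of $H$, the form $f_k(p)$ is locally conserved by $v_H$, i.e. $\mathcal L_{v_H}f_k(p)$ is closed. (2) In (1), $f_k(p)$ need not be globally conserved, i.e. $\mathcal L_{v_H}f_k(p)$ need not be exact, even if all $\mathcal L_{v_x}H$ are exact: let $M=\mathbb R^3$, $n=2$, $\omega=dx\wedge dy\wedge dz$, $H=-x\,dy$, $v_H=\frac{\partial}{\partial z}$, and let the two-dimensional abelian Lie algebra $\mathfrak g=\langle a,b\rangle_{\mathbb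 R}$ act by $v_a=\frac{\partial}{\partial x}$, $v_b=\frac{\partial}{\partial y}$. Then $v_H$ is a Hamiltonian vector field of $H$, the action preserves $\omega$, all $\mathcal L_{v_x}H$ are exact (in particular closed), and $f_1(a)=-y\,dz$, $f_1(b)=x\,dz$, $f_2(a\wedge b)=-z$ define a co-momentum map. Moreover $a\wedge b\in Z_2(\mathfrak g)$, but $\mathcal L_{v_H}f_2(a\wedge b)=-1$ is not exact (an exact $0$-form is $0$). -/

import Mathlib

open scoped Manifold

noncomputable section

/-! ## Differential forms and vector fields on a manifold

`M` is a smooth manifold without boundary modelled on the finite-dimensional real normed space `E`.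
A *form field* of degree `k` assigns to each point an alternating `k`-form on the tangent space,
without any regularity; the smooth ones form the real vector space `SmoothForm E M k`. -/

/-- Smooth vector fields on `M`. -/
abbrev SmoothVectorField (E : Type*) [NormedAddCommGroup E] [NormedSpace ℝ E]
    (M : Type*) [TopologicalSpace M] [ChartedSpace E M]
    [IsManifold 𝓘(ℝ, E) ((⊤ : ℕ∞) : WithTop ℕ∞) M] :=
  ContMDiffSection 𝓘(ℝ, E) E ((⊤ : ℕ∞) : WithTop ℕ∞) (TangentSpace 𝓘(ℝ, E) : M → Type _)

/-- Fields of alternating `k`-forms on `M`, with no regularity required. -/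
abbrev FormField (E : Type*) [NormedAddCommGroup E] [NormedSpace ℝ E]
    (M : Type*) [TopologicalSpace M] [ChartedSpace E M] (k : ℕ) :=
  ∀ x : M, TangentSpace 𝓘(ℝ, E) x [⋀^Fin k]→L[ℝ] ℝ

namespace FormField

variable {E : Type*} [NormedAddCommGroup E] [NormedSpace ℝ E]
  {M : Type*} [TopologicalSpace M] [ChartedSpace E M] {k l : ℕ}

/-- The coordinate expression of a form field in the preferred chart at `x₀`: its pullback under
the inverse of the chart, a form on (the chart's target in) `E`. -/
def inChart (x₀ : M) (α : FormField E M k) (y : E) : E [⋀^Fin k]→L[ℝ] ℝ :=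
  ContinuousAlternatingMap.compContinuousLinearMap (M := E)
    (α ((extChartAt 𝓘(ℝ, E) x₀).symm y))
    (mfderiv 𝓘(ℝ, E) 𝓘(ℝ, E) (extChartAt 𝓘(ℝ, E) x₀).symm y)

/-- Transport of an alternating form on `E` to the tangent space at `x₀` by the derivative of the
preferred chart at `x₀`. -/
def ofChart (x₀ : M) (β : E [⋀^Fin k]→L[ℝ] ℝ) : TangentSpace 𝓘(ℝ, E) x₀ [⋀^Fin k]→L[ℝ] ℝ :=
  ContinuousAlternatingMap.compContinuousLinearMap (M' := E) β
    (mfderiv 𝓘(ℝ, E) 𝓘(ℝ, E) (extChartAt 𝓘(ℝ, E) x₀) x₀)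

/-- A form field is smooth if all its coordinate expressions are smooth. -/
def IsSmooth (α : FormField E M k) : Prop :=
  ∀ x₀ : M, ContDiffOn ℝ ((⊤ : ℕ∞) : WithTop ℕ∞) (inChart x₀ α) (extChartAt 𝓘(ℝ, E) x₀).target

/-- Exterior derivative, computed in charts. -/
def d (α : FormField E M k) : FormField E M (k + 1) := fun x₀ =>
  ofChart x₀ (extDeriv (inChart x₀ α) (extChartAt 𝓘(ℝ, E) x₀ x₀))

/-- Contraction `ι_V α = α(V, ·, …, ·)`. -/
def contract (V : ∀ x : M, TangentSpace 𝓘(ℝ, E) x) (α : FormField E M (k + 1)) :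
    FormField E M k := fun x =>
  ContinuousAlternatingMap.curryLeft (E := E) (α x) (V x)

/-- Lie derivative on the model space:
`(L_V α)(w₁,…,w_k) = (D_V α)(w₁,…,w_k) + ∑ᵢ α(w₁,…,DV(wᵢ),…,w_k)`, i.e. the derivative at `t = 0`
of the pullback of `α` under the flow of `V`. -/
def lieDerivModel (V : E → E) (α : E → E [⋀^Fin k]→L[ℝ] ℝ) (y : E) : E [⋀^Fin k]→L[ℝ] ℝ :=
  fderiv ℝ α y (V y) +
    (α y).fderivCompContinuousLinearMap (ContinuousLinearMap.id ℝ E) (fderiv ℝ V y)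

/-- Lie derivative `L_V α`, computed in charts. -/
def lieDeriv (V : ∀ x : M, TangentSpace 𝓘(ℝ, E) x) (α : FormField E M k) : FormField E M k :=
  fun x₀ => ofChart x₀
    (lieDerivModel
      (fun y => VectorField.mpullback 𝓘(ℝ, E) 𝓘(ℝ, E) (extChartAt 𝓘(ℝ, E) x₀).symm V y)
      (inChart x₀ α) (extChartAt 𝓘(ℝ, E) x₀ x₀))

/-- Identification of form fields of equal degrees. -/
def castDeg (h : k = l) (α : FormField E M k) : FormField E M l := h ▸ α

/-- `ι(V₁ ∧ ⋯ ∧ V_k) = ι_{V_k} ⋯ ι_{V₁}`. -/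
def contractMulti {j : ℕ} : (k : ℕ) → (Fin k → ∀ x : M, TangentSpace 𝓘(ℝ, E) x) →
    FormField E M (j + k) → FormField E M j
  | 0, _, α => α
  | k + 1, V, α => contractMulti k (fun i => V i.succ) (contract (k := j + k) (V 0) α)

end FormField

/-- The real vector space `Ω^k(M)` of smooth differential `k`-forms. -/
def SmoothForm (E : Type*) [NormedAddCommGroup E] [NormedSpace ℝ E]
    (M : Type*) [TopologicalSpace M] [ChartedSpace E M] (k : ℕ) :
    Submodule ℝ (FormField E M k) where
  carrier := {α | α.IsSmooth}
  add_mem' := fun {_ _} ha hb x₀ => (ha x₀).add (hb x₀)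
  zero_mem' := fun _ => contDiffOn_const (c := (0 : E [⋀^Fin k]→L[ℝ] ℝ))
  smul_mem' := fun c _ ha x₀ => (ha x₀).const_smul c

section Notions

variable {E : Type*} [NormedAddCommGroup E] [NormedSpace ℝ E]
  {M : Type*} [TopologicalSpace M] [ChartedSpace E M] {k : ℕ}

/-- Closed differential forms. -/
def IsClosedForm (α : FormField E M k) : Prop := α.IsSmooth ∧ α.d = 0

/-- Exact differential forms; there are no nonzero forms of degree `-1`, so that an exact
`0`-form is zero. -/
def IsExactForm : {k : ℕ} → FormField E M k → Prop
  | 0, α => α = 0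
  | k + 1, α => ∃ β : SmoothForm E M k, (β : FormField E M k).d = α

/-- `α` is locally conserved by the vector field `V`: `L_V α` is closed. -/
def IsLocallyConserved (V : ∀ x : M, TangentSpace 𝓘(ℝ, E) x) (α : FormField E M k) : Prop :=
  IsClosedForm (α.lieDeriv V)

/-- `α` is globally conserved by the vector field `V`: `L_V α` is exact. -/
def IsGloballyConserved (V : ∀ x : M, TangentSpace 𝓘(ℝ, E) x) (α : FormField E M k) : Prop :=
  IsExactForm (α.lieDeriv V)

/-- `V` is a Hamiltonian vector field of the `m`-form `α` with respect to the `(m+2)`-form `ω`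
(so `n = m + 1`): `dα = -ι_V ω`. -/
def IsHamiltonianVectorField {m : ℕ} (ω : FormField E M (m + 2)) (α : FormField E M m)
    (V : ∀ x : M, TangentSpace 𝓘(ℝ, E) x) : Prop :=
  α.d = -ω.contract V

end Notions

/-! ## Lie algebra homology -/

section LieHomology

variable (𝔤 : Type*) [LieRing 𝔤] [LieAlgebra ℝ 𝔤]

/-- The right-hand side of the formula for the homology differential on `x₁ ∧ ⋯ ∧ x_{k+2}`:
`∑_{a<b} (-1)^{a+b} [x_a, x_b] ∧ x₁ ∧ ⋯ x̂_a ⋯ x̂_b ⋯ ∧ x_{k+2}`. The pairs `a < b` are written as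
`a = i.castSucc`, `b = j.succ` with `i ≤ j`. -/
def lieBoundaryFun (k : ℕ) (x : Fin (k + 2) → 𝔤) : ⋀[ℝ]^(k + 1) 𝔤 :=
  ∑ i : Fin (k + 1), ∑ j ≥ i, (-1 : ℝ) ^ ((i.castSucc : ℕ) + (j.succ : ℕ)) •
    exteriorPower.ιMulti ℝ (k + 1)
      (Matrix.vecCons ⁅x i.castSucc, x j.succ⁆ (j.removeNth (i.castSucc.removeNth x)))

/-- The trilinear expression `[x, y] ∧ z₁ ∧ ⋯ ∧ z_k`. -/
def lieBoundaryAux (k : ℕ) : 𝔤 →ₗ[ℝ] 𝔤 →ₗ[ℝ] 𝔤 [⋀^Fin k]→ₗ[ℝ] ⋀[ℝ]^(k + 1) 𝔤 :=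
  (LieModule.toEnd ℝ 𝔤 𝔤 : 𝔤 →ₗ[ℝ] 𝔤 →ₗ[ℝ] 𝔤).compr₂
    (AlternatingMap.curryLeft (exteriorPower.ιMulti ℝ (k + 1)))

theorem lieBoundaryFun_eq (k : ℕ) (x : Fin (k + 2) → 𝔤) :
    lieBoundaryFun 𝔤 k x = (-(1 / 2) : ℝ) • AlternatingMap.alternatizeUncurryFin
      (AlternatingMap.alternatizeUncurryFinLM ∘ₗ lieBoundaryAux 𝔤 k) x := by
  rw [AlternatingMap.alternatizeUncurryFin_alternatizeUncurryFinLM_comp_apply, Finset.smul_sum]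
  refine Finset.sum_congr rfl fun i _ => ?_
  rw [Finset.smul_sum]
  refine Finset.sum_congr rfl fun j _ => ?_
  have h (a b : 𝔤) (z : Fin k → 𝔤) : lieBoundaryAux 𝔤 k a b z =
      exteriorPower.ιMulti ℝ (k + 1) (Matrix.vecCons ⁅a, b⁆ z) := rfl
  have h' (a b : 𝔤) (z : Fin k → 𝔤) :
      lieBoundaryAux 𝔤 k b a z = -lieBoundaryAux 𝔤 k a b z := by
    rw [h, h, ← lie_skew b a, ← neg_one_smul ℝ ⁅a, b⁆]
    exact ((exteriorPower.ιMulti ℝ (k + 1)).map_vecCons_smul z (-1 : ℝ) ⁅a, b⁆).trans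
      (neg_one_smul ℝ _)
  rw [h' (x i.castSucc) (x j.succ), h, sub_neg_eq_add, ← two_smul ℝ, smul_comm, smul_smul,
    ← Int.cast_smul_eq_zsmul ℝ, smul_smul]
  congr 1
  simp only [Fin.val_castSucc, Fin.val_succ]
  push_cast
  ring

/-- The homology differential as an alternating map of `k + 2` arguments. -/
def lieBoundaryAlt (k : ℕ) : 𝔤 [⋀^Fin (k + 2)]→ₗ[ℝ] ⋀[ℝ]^(k + 1) 𝔤 where
  toFun := lieBoundaryFun 𝔤 k
  map_update_add' := by
    intro _ x i a b
    simp only [lieBoundaryFun_eq]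
    rw [AlternatingMap.map_update_add, smul_add]
  map_update_smul' := by
    intro _ x i a b
    simp only [lieBoundaryFun_eq]
    rw [AlternatingMap.map_update_smul, smul_comm]
  map_eq_zero_of_eq' := by
    intro x i j h hij
    simp only [lieBoundaryFun_eq]
    rw [AlternatingMap.map_eq_zero_of_eq _ _ h hij, smul_zero]

/-- The Lie algebra homology differential `∂_{k+1} : Λ^{k+1} 𝔤 → Λ^k 𝔤`. -/
def lieBoundary : (k : ℕ) → ⋀[ℝ]^(k + 1) 𝔤 →ₗ[ℝ] ⋀[ℝ]^k 𝔤
  | 0 => 0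
  | k + 1 => exteriorPower.alternatingMapLinearEquiv (lieBoundaryAlt 𝔤 k)

/-- The cycles `Z_{k+1}(𝔤) = ker ∂_{k+1}`. -/
def lieCycles (k : ℕ) : Submodule ℝ (⋀[ℝ]^(k + 1) 𝔤) := LinearMap.ker (lieBoundary 𝔤 k)

end LieHomology

/-! ## Infinitesimal actions and co-momentum maps

Throughout `n = m + 1`, so that `ω` has degree `n + 1 = m + 2` and `H` has degree `n - 1 = m`. -/

section Actions

variable {E : Type*} [NormedAddCommGroup E] [NormedSpace ℝ E]
  {M : Type*} [TopologicalSpace M] [ChartedSpace E M]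
  [IsManifold 𝓘(ℝ, E) ((⊤ : ℕ∞) : WithTop ℕ∞) M]
  {𝔤 : Type*} [LieRing 𝔤] [LieAlgebra ℝ 𝔤] {m : ℕ}

/-- `v : 𝔤 → 𝔛(M)` is an infinitesimal action: a homomorphism of Lie algebras. -/
def IsInfinitesimalAction (v : 𝔤 →ₗ[ℝ] SmoothVectorField E M) : Prop :=
  ∀ x y : 𝔤, (v ⁅x, y⁆ : ∀ z : M, TangentSpace 𝓘(ℝ, E) z) =
    VectorField.mlieBracket 𝓘(ℝ, E) (v x) (v y)

/-- The infinitesimal action preserves `ω`. -/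
def IsMultisymplecticAction (ω : FormField E M (m + 2))
    (v : 𝔤 →ₗ[ℝ] SmoothVectorField E M) : Prop :=
  ∀ x : 𝔤, ω.lieDeriv (v x) = 0

/-- `L_{v_x} H` is closed for all `x`. -/
def IsLocallyPreserving (H : FormField E M m) (v : 𝔤 →ₗ[ℝ] SmoothVectorField E M) : Prop :=
  ∀ x : 𝔤, IsClosedForm (H.lieDeriv (v x))

/-- `L_{v_x} H` is exact for all `x`. -/
def IsGloballyPreserving (H : FormField E M m) (v : 𝔤 →ₗ[ℝ] SmoothVectorField E M) : Prop :=
  ∀ x : 𝔤, IsExactForm (H.lieDeriv (v x))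

/-- The sign `ς(k) = -(-1)^{k(k+1)/2}`. -/
def multiSign (k : ℕ) : ℝ := -(-1) ^ (k * (k + 1) / 2)

variable (E M 𝔤) in
/-- Families of linear maps `f_k : Λ^k 𝔤 → Ω^{n-k}(M)`; the form degree `j = n - k` is an explicit
index, subject to `k + j = n`. -/
abbrev MomentumComponents (n : ℕ) :=
  ∀ k j : ℕ, k + j = n → (⋀[ℝ]^k 𝔤 →ₗ[ℝ] SmoothForm E M j)

/-- `(f)` is a homotopy co-momentum map for the action `v` on `(M, ω)`, `n = m + 1`.
The component `f₀` is zero by convention; the component `f_{n+1}`, zero as well, is omitted. As both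
sides of the structure equation
`-f_{k-1}(∂p) = d f_k(p) + ς(k) ι(v_p) ω` are linear in `p`,
it is stated for the generators `p = x₁ ∧ ⋯ ∧ x_k`. -/
structure IsCoMomentumMap (ω : FormField E M (m + 2)) (v : 𝔤 →ₗ[ℝ] SmoothVectorField E M)
    (f : MomentumComponents E M 𝔤 (m + 1)) : Prop where
  zero_component : f 0 (m + 1) (Nat.zero_add _) = 0
  hamiltonian : ∀ x : ⋀[ℝ]^1 𝔤, ∃ V : SmoothVectorField E M,
    IsHamiltonianVectorField ω (f 1 m (Nat.add_comm 1 m) x : FormField E M m) V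
  /-- The structure equation for `1 ≤ k + 1 ≤ n`. -/
  structure_eq : ∀ (k j : ℕ) (h : k + 1 + j = m + 1) (x : Fin (k + 1) → 𝔤),
    -(f k (j + 1) (by omega) (lieBoundary 𝔤 k (exteriorPower.ιMulti ℝ (k + 1) x)) :
        FormField E M (j + 1)) =
      (f (k + 1) j h (exteriorPower.ιMulti ℝ (k + 1) x) : FormField E M j).d +
        multiSign (k + 1) • FormField.contractMulti (j := j + 1) (k + 1) (fun i => v (x i))
          (ω.castDeg (by omega))
  /-- The structure equation for `k = n + 1`. -/
  structure_eq_top : ∀ x : Fin (m + 2) → 𝔤,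
    -(f (m + 1) 0 rfl (lieBoundary 𝔤 (m + 1) (exteriorPower.ιMulti ℝ (m + 2) x)) :
        FormField E M 0) =
      multiSign (m + 2) • FormField.contractMulti (j := 0) (m + 2) (fun i => v (x i))
          (ω.castDeg (by omega))
  momentum : ∀ x : 𝔤, IsHamiltonianVectorField ω
    (f 1 m (Nat.add_comm 1 m) (exteriorPower.ιMulti ℝ 1 fun _ => x) : FormField E M m) (v x)

end Actions

/-- The manifold `ℝ³` with its coordinates `x = z 0`, `y = z 1`, `z = z 2`. -/
abbrev R3 := EuclideanSpace ℝ (Fin 3)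

end

/-! Write `U` for a Hamiltonian vector field of `H`. The structure equation says that on
decomposable `p` the form `d f_k(p) + f_{k-1}(∂p)` equals `-ς(k) ι(v_p) ω`, and `L_U` kills the
right-hand side for two reasons. First, Cartan's formula and `dω = 0` give `L_U ω = d ι_U ω = -ddH =
0`. Second, applying `L_{v_x}` to `ι_U ω = -dH` gives `ι_{[v_x,U]} ω = -d L_{v_x} H = 0`, because
`L_{v_x} ω = 0` and `L_{v_x} H` is closed. Since `[L_U, ι_V] = ι_{[U,V]}`, moving `L_U` past the
contractions with the fields `v_x` produces only zero terms (`lieDeriv_contractMulti_eq_zero`). By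
linearity `L_U (d f_k(p) + f_{k-1}(∂p)) = 0` for all `p`; on a cycle this reads `d L_U f_k(p) = L_U
d f_k(p) = 0`.

The supporting Cartan calculus (`d d = 0`, Cartan's formula, `[d, L_V] = 0`, `[L_V, ι_W] =
ι_{[V,W]}`) is proved on the model space and transferred by charts. The crux of the transfer is
`inChart_d`: `d` at a point is defined in the chart preferred at that point, which varies with the
point, so naturality of the exterior derivative under coordinate changes is needed before `d` can be
iterated.

In the counterexample `H`, `f₁` and `f₂` have linear coefficients, while `ω` and all vector fields
are constant, so every claim becomes an identity of determinants. -/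

noncomputable section

/-! ### Cartan calculus on the model space -/

namespace FormField

section Model

open ContinuousAlternatingMap

variable {E : Type*} [NormedAddCommGroup E] [NormedSpace ℝ E] {k : ℕ}

variable (E k) in
/-- Contraction of alternating forms with vectors, as a continuous bilinear map. -/
def interiorCLM : E →L[ℝ] (E [⋀^Fin (k + 1)]→L[ℝ] ℝ) →L[ℝ] (E [⋀^Fin k]→L[ℝ] ℝ) :=
  (curryLeftLI (𝕜 := ℝ) (E := E) (F := ℝ) (n := k)).toContinuousLinearMap.flip

@[simp]
theorem interiorCLM_apply (v : E) (a : E [⋀^Fin (k + 1)]→L[ℝ] ℝ) :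
    interiorCLM E k v a = a.curryLeft v :=
  rfl

theorem fderiv_curryLeft_apply {V : E → E} {α : E → E [⋀^Fin (k + 1)]→L[ℝ] ℝ} {y : E}
    (hV : DifferentiableAt ℝ V y) (hα : DifferentiableAt ℝ α y) (h : E) :
    fderiv ℝ (fun z => (α z).curryLeft (V z)) y h =
      (α y).curryLeft (fderiv ℝ V y h) + (fderiv ℝ α y h).curryLeft (V y) := by
  have := ((interiorCLM E k).hasFDerivAt_of_bilinear hV.hasFDerivAt hα.hasFDerivAt).fderiv
  simp only [interiorCLM_apply] at this
  rw [this, add_comm]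
  rfl

theorem contDiffOn_curryLeft {V : E → E} {α : E → E [⋀^Fin (k + 1)]→L[ℝ] ℝ} {s : Set E}
    {r : WithTop ℕ∞} (hV : ContDiffOn ℝ r V s) (hα : ContDiffOn ℝ r α s) :
    ContDiffOn ℝ r (fun z => (α z).curryLeft (V z)) s :=
  (interiorCLM E k).isBoundedBilinearMap.contDiff.comp_contDiffOn (hV.prodMk hα)

theorem contDiffOn_extDeriv {α : E → E [⋀^Fin k]→L[ℝ] ℝ} {s : Set E} (hs : IsOpen s)
    (hα : ContDiffOn ℝ ((⊤ : ℕ∞) : WithTop ℕ∞) α s) :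
    ContDiffOn ℝ ((⊤ : ℕ∞) : WithTop ℕ∞) (extDeriv α) s :=
  (alternatizeUncurryFinCLM ℝ E ℝ).contDiff.comp_contDiffOn
    (hα.fderiv_of_isOpen hs (by simp))

/-- Cartan's formula on the model space, in positive degree. -/
theorem lieDerivModel_eq_extDeriv_add {V : E → E} {α : E → E [⋀^Fin (k + 1)]→L[ℝ] ℝ} {y : E}
    (hV : DifferentiableAt ℝ V y) (hα : DifferentiableAt ℝ α y) :
    lieDerivModel V α y = extDeriv (fun z => (α z).curryLeft (V z)) y +
      (extDeriv α y).curryLeft (V y) := by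
  ext w
  rw [lieDerivModel, fderivCompContinuousLinearMap_eq_alternatizeUncurryFin]
  simp only [extDeriv, ContinuousAlternatingMap.add_apply, curryLeft_apply_apply,
    alternatizeUncurryFin_apply, fderiv_curryLeft_apply hV hα, ContinuousLinearMap.comp_apply,
    alternatizeUncurryFinCLM_apply, ContinuousLinearMap.postcomp_apply]
  -- The term with index `0` in `(dα)(V, w)` is `(D_V α)(w)`; the others cancel the part of `d(ι_V
  -- α)` in which the derivative falls on `α`. What remains is the `DV` part of the Lie derivative.
  rw [Fin.sum_univ_succ (n := k + 1)]
  have hr (x : Fin (k + 1)) : x.succ.removeNth (Matrix.vecCons (V y) w) =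
      Matrix.vecCons (V y) (x.removeNth w) := by
    ext i
    refine Fin.cases ?_ (fun j => ?_) i <;> simp [Fin.removeNth]
  simp [pow_succ, Finset.sum_add_distrib, hr]
  ring

/-- Cartan's formula on the model space, in degree zero. -/
theorem lieDerivModel_zero_eq (V : E → E) (α : E → E [⋀^Fin 0]→L[ℝ] ℝ) (y : E) :
    lieDerivModel V α y = (extDeriv α y).curryLeft (V y) := by
  ext w
  simp [lieDerivModel, extDeriv, alternatizeUncurryFin_apply, 
    fderivCompContinuousLinearMap_of_isEmpty]

/-- Only the Leibniz rule is involved: differentiating `W` on the left gives `α(DW(V), …)`, while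
`L_V α` with `W` in its first slot has the extra term `α(DV(W), …)`. Their difference is the
contraction with `[V, W] = DW(V) - DV(W)`. -/
theorem lieDerivModel_curryLeft {V W : E → E} {α : E → E [⋀^Fin (k + 1)]→L[ℝ] ℝ} {y : E}
    (hW : DifferentiableAt ℝ W y) (hα : DifferentiableAt ℝ α y) :
    lieDerivModel V (fun z => (α z).curryLeft (W z)) y =
      (lieDerivModel V α y).curryLeft (W y) +
        (α y).curryLeft (VectorField.lieBracket ℝ V W y) := by
  ext w
  simp only [lieDerivModel, fderiv_curryLeft_apply hW hα, VectorField.lieBracket, map_sub, 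
    ContinuousAlternatingMap.add_apply, curryLeft_apply_apply, fderivCompContinuousLinearMap_apply,
    ContinuousAlternatingMap.sub_apply, Fin.sum_univ_succ]
  have h0 : (fun j => (Function.update (fun _ => ContinuousLinearMap.id ℝ E) 0 (fderiv ℝ V y) j)
      (Matrix.vecCons (W y) w j)) = Matrix.vecCons (fderiv ℝ V y (W y)) w := by
    ext j
    refine Fin.cases ?_ (fun j => ?_) j <;> simp
  have hs (i : Fin k) : (fun j => (Function.update (fun _ => ContinuousLinearMap.id ℝ E) i.succ
      (fderiv ℝ V y) j) (Matrix.vecCons (W y) w j)) = Matrix.vecCons (W y) fun j =>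
        (Function.update (fun _ => ContinuousLinearMap.id ℝ E) i (fderiv ℝ V y) j) (w j) := by
    ext j
    refine Fin.cases ?_ (fun j => ?_) j
    · simp [Function.update_apply, (Fin.succ_ne_zero i).symm]
    · simp [Function.update_apply]
  simp only [h0, hs]
  abel

theorem _root_.Filter.EventuallyEq.lieDerivModel_eq {V W : E → E} {α β : E → E [⋀^Fin k]→L[ℝ] ℝ}
    {y : E} (hV : V =ᶠ[nhds y] W) (hα : α =ᶠ[nhds y] β) :
    lieDerivModel V α y = lieDerivModel W β y := by
  simp only [lieDerivModel, hV.fderiv_eq, hα.fderiv_eq, hV.eq_of_nhds, hα.eq_of_nhds]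

section Open

variable {V : E → E} {α : E → E [⋀^Fin k]→L[ℝ] ℝ} {s : Set E} {y : E}

theorem differentiableAt_of_contDiffOn {F : Type*} [NormedAddCommGroup F] [NormedSpace ℝ F]
    {f : E → F} (hs : IsOpen s) (hf : ContDiffOn ℝ ((⊤ : ℕ∞) : WithTop ℕ∞) f s) (hy : y ∈ s) :
    DifferentiableAt ℝ f y :=
  (hf.contDiffAt (hs.mem_nhds hy)).differentiableAt (by simp)

theorem extDeriv_extDeriv_eq_zero_of_contDiffOn (hs : IsOpen s)
    (hα : ContDiffOn ℝ ((⊤ : ℕ∞) : WithTop ℕ∞) α s) (hy : y ∈ s) : extDeriv (extDeriv α) y = 0 :=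
  extDeriv_extDeriv_apply (hα.contDiffAt (hs.mem_nhds hy)) (by
    simpa using WithTop.coe_le_coe.2 (le_top (a := (2 : ℕ∞))))

end Open

end Model

end FormField

/-! ### Coordinate expressions and change of chart -/

namespace FormField

section Charts

open ContinuousAlternatingMap VectorField

variable {E : Type*} [NormedAddCommGroup E] [NormedSpace ℝ E]
  {M : Type*} [TopologicalSpace M] [ChartedSpace E M] {k : ℕ}

/-- The derivative of the inverse of the preferred chart at `x₀`, as an endomorphism of the
model space. -/
def symmDeriv (x₀ : M) (y : E) : E →L[ℝ] E :=
  mfderiv 𝓘(ℝ, E) 𝓘(ℝ, E) (extChartAt 𝓘(ℝ, E) x₀).symm y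

/-- A vector field in the preferred chart at `x₀`. -/
def chartVF (x₀ : M) (V : ∀ x : M, TangentSpace 𝓘(ℝ, E) x) (y : E) : E :=
  mpullback 𝓘(ℝ, E) 𝓘(ℝ, E) (extChartAt 𝓘(ℝ, E) x₀).symm V y

theorem inChart_apply (x₀ : M) (α : FormField E M k) (y : E) (w : Fin k → E) :
    inChart x₀ α y w = α ((extChartAt 𝓘(ℝ, E) x₀).symm y) (fun i => symmDeriv x₀ y (w i)) :=
  rfl

variable [IsManifold 𝓘(ℝ, E) ((⊤ : ℕ∞) : WithTop ℕ∞) M]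

theorem isInvertible_symmDeriv {x₀ : M} {y : E} (hy : y ∈ (extChartAt 𝓘(ℝ, E) x₀).target) :
    (symmDeriv x₀ y).IsInvertible := by
  have : IsManifold 𝓘(ℝ, E) 1 M := .of_le (n := ((⊤ : ℕ∞) : WithTop ℕ∞)) (by simp)
  have h := isInvertible_mfderivWithin_extChartAt_symm (I := 𝓘(ℝ, E)) hy
  rw [ModelWithCorners.range_eq_univ, mfderivWithin_univ] at h
  exact h

theorem mdifferentiableAt_extChartAt_symm {x₀ : M} {y : E}
    (hy : y ∈ (extChartAt 𝓘(ℝ, E) x₀).target) :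
    MDifferentiableAt 𝓘(ℝ, E) 𝓘(ℝ, E) (extChartAt 𝓘(ℝ, E) x₀).symm y := by
  have : IsManifold 𝓘(ℝ, E) 1 M := .of_le (n := ((⊤ : ℕ∞) : WithTop ℕ∞)) (by simp)
  have h := mdifferentiableWithinAt_extChartAt_symm (I := 𝓘(ℝ, E)) hy
  rwa [ModelWithCorners.range_eq_univ, mdifferentiableWithinAt_univ] at h

/-- The tangent space at `x₀` is identified with `E` by the preferred chart at `x₀`, so the
derivative of that chart at its own base point is the identity. -/
theorem ofChart_eq (x₀ : M) (β : E [⋀^Fin k]→L[ℝ] ℝ) : ofChart x₀ β = β := by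
  have : IsManifold 𝓘(ℝ, E) 1 M := .of_le (n := ((⊤ : ℕ∞) : WithTop ℕ∞)) (by simp)
  ext w
  rw [ofChart, mfderiv_extChartAt_self]
  rfl

theorem symmDeriv_self (x₀ : M) :
    symmDeriv x₀ (extChartAt 𝓘(ℝ, E) x₀ x₀) = ContinuousLinearMap.id ℝ E := by
  have : IsManifold 𝓘(ℝ, E) 1 M := .of_le (n := ((⊤ : ℕ∞) : WithTop ℕ∞)) (by simp)
  have h := mfderivWithin_extChartAt_symm_comp_mfderiv_extChartAt' (I := 𝓘(ℝ, E))
    (mem_extChartAt_source x₀)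
  rw [mfderiv_extChartAt_self, ModelWithCorners.range_eq_univ, mfderivWithin_univ] at h
  exact h

theorem inChart_self (x₀ : M) (α : FormField E M k) :
    inChart x₀ α (extChartAt 𝓘(ℝ, E) x₀ x₀) = α x₀ := by
  ext w
  rw [inChart_apply, symmDeriv_self]
  have h : (extChartAt 𝓘(ℝ, E) x₀).symm (extChartAt 𝓘(ℝ, E) x₀ x₀) = x₀ := extChartAt_to_inv x₀
  -- All tangent spaces are definitionally `E`, so the base point can be rewritten without
  -- transport.
  exact congrArg (fun x => (show E [⋀^Fin k]→L[ℝ] ℝ from α x) w) h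

theorem chartVF_self (x₀ : M) (V : ∀ x : M, TangentSpace 𝓘(ℝ, E) x) :
    chartVF x₀ V (extChartAt 𝓘(ℝ, E) x₀ x₀) = V x₀ := by
  have h : (extChartAt 𝓘(ℝ, E) x₀).symm (extChartAt 𝓘(ℝ, E) x₀ x₀) = x₀ := extChartAt_to_inv x₀
  change (symmDeriv x₀ (extChartAt 𝓘(ℝ, E) x₀ x₀)).inverse (V _) = V x₀
  rw [symmDeriv_self, ContinuousLinearMap.inverse_id]
  exact congrArg (fun x => (show E from V x)) h

theorem symmDeriv_chartVF {x₀ : M} {y : E} (hy : y ∈ (extChartAt 𝓘(ℝ, E) x₀).target)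
    (V : ∀ x : M, TangentSpace 𝓘(ℝ, E) x) :
    symmDeriv x₀ y (chartVF x₀ V y) = V ((extChartAt 𝓘(ℝ, E) x₀).symm y) := by
  change symmDeriv x₀ y ((symmDeriv x₀ y).inverse (V _)) = _
  -- `ContinuousLinearMap.inverse` is a true inverse only for invertible maps and is `0` otherwise;
  -- membership in the chart target excludes that default.
  obtain ⟨e, he⟩ := isInvertible_symmDeriv hy
  rw [← he, ContinuousLinearMap.inverse_equiv]
  exact e.apply_symm_apply _

theorem inChart_contract {x₀ : M} {y : E} (hy : y ∈ (extChartAt 𝓘(ℝ, E) x₀).target)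
    (V : ∀ x : M, TangentSpace 𝓘(ℝ, E) x) (α : FormField E M (k + 1)) :
    inChart x₀ (contract V α) y = (inChart x₀ α y).curryLeft (chartVF x₀ V y) := by
  ext w
  rw [inChart_apply, curryLeft_apply_apply, inChart_apply]
  refine congrArg (show E [⋀^Fin (k + 1)]→L[ℝ] ℝ from α _) (funext fun i => ?_)
  refine Fin.cases ?_ (fun i => rfl) i
  exact (symmDeriv_chartVF hy V).symm

/-- Chain rule for the inverse chart at `x₀`, factored locally as the coordinate change followed by
the inverse chart at `x`. -/
theorem symmDeriv_eq_comp {x₀ x : M} {y : E} (hy : y ∈ (extChartAt 𝓘(ℝ, E) x₀).target)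
    (hx : (extChartAt 𝓘(ℝ, E) x₀).symm y ∈ (extChartAt 𝓘(ℝ, E) x).source) :
    symmDeriv x₀ y = symmDeriv x (extChartAt 𝓘(ℝ, E) x ((extChartAt 𝓘(ℝ, E) x₀).symm y)) ∘L
      fderiv ℝ (extChartAt 𝓘(ℝ, E) x ∘ (extChartAt 𝓘(ℝ, E) x₀).symm) y := by
  have : IsManifold 𝓘(ℝ, E) 1 M := .of_le (n := ((⊤ : ℕ∞) : WithTop ℕ∞)) (by simp)
  have h₀ := mdifferentiableAt_extChartAt_symm hy
  have h₁ : MDifferentiableAt 𝓘(ℝ, E) 𝓘(ℝ, E) (extChartAt 𝓘(ℝ, E) x)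
      ((extChartAt 𝓘(ℝ, E) x₀).symm y) := mdifferentiableAt_extChartAt (by simpa using hx)
  have h₂ := mdifferentiableAt_extChartAt_symm ((extChartAt 𝓘(ℝ, E) x).map_source hx)
  have hc : (extChartAt 𝓘(ℝ, E) x₀).symm =ᶠ[nhds y] (extChartAt 𝓘(ℝ, E) x).symm ∘
      (extChartAt 𝓘(ℝ, E) x ∘ (extChartAt 𝓘(ℝ, E) x₀).symm) := by
    filter_upwards [h₀.continuousAt.preimage_mem_nhds
      ((isOpen_extChartAt_source x).mem_nhds hx)] with z hz
    exact ((extChartAt 𝓘(ℝ, E) x).left_inv hz).symm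
  have h := hc.mfderiv_eq (I := 𝓘(ℝ, E)) (I' := 𝓘(ℝ, E))
  rw [mfderiv_comp y (I' := 𝓘(ℝ, E)) (by exact h₂) (h₁.comp y h₀)] at h
  rw [mfderiv_eq_fderiv] at h
  exact h

/-- The exterior derivative may be computed in any chart. -/
theorem inChart_d {x₀ : M} {y : E} (hy : y ∈ (extChartAt 𝓘(ℝ, E) x₀).target)
    {α : FormField E M k} (hα : α.IsSmooth) :
    inChart x₀ α.d y = extDeriv (inChart x₀ α) y := by
  set x := (extChartAt 𝓘(ℝ, E) x₀).symm y with hx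
  set τ := extChartAt 𝓘(ℝ, E) x ∘ (extChartAt 𝓘(ℝ, E) x₀).symm with hτ
  have hxs : x ∈ (extChartAt 𝓘(ℝ, E) x).source := mem_extChartAt_source x
  have hτc : ContDiffAt ℝ ((⊤ : ℕ∞) : WithTop ℕ∞) τ y := by
    have h := contDiffWithinAt_ext_coord_change (I := 𝓘(ℝ, E))
      (n := ((⊤ : ℕ∞) : WithTop ℕ∞)) x x₀ (y := y) (by
        rw [PartialEquiv.trans_source]
        exact ⟨hy, hxs⟩)
    rwa [ModelWithCorners.range_eq_univ, contDiffWithinAt_univ] at h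
  -- Near `y`, the expression of `α` in the chart at `x₀` is the pullback along `τ` of its
  -- expression in the chart at `x`, to which naturality of `extDeriv` applies.
  have hpull : inChart x₀ α =ᶠ[nhds y] fun z =>
      (inChart x α (τ z)).compContinuousLinearMap (fderiv ℝ τ z) := by
    filter_upwards [(isOpen_extChartAt_target x₀).mem_nhds hy,
      (mdifferentiableAt_extChartAt_symm hy).continuousAt.preimage_mem_nhds
        ((isOpen_extChartAt_source x).mem_nhds hxs)] with z hz hzs
    ext w
    rw [compContinuousLinearMap_apply, inChart_apply, inChart_apply, symmDeriv_eq_comp hz hzs]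
    have h : (extChartAt 𝓘(ℝ, E) x₀).symm z = (extChartAt 𝓘(ℝ, E) x).symm (τ z) :=
      ((extChartAt 𝓘(ℝ, E) x).left_inv hzs).symm
    exact congrArg (fun p => (show E [⋀^Fin k]→L[ℝ] ℝ from α p) _) h
  rw [hpull.extDeriv_eq, extDeriv_pullback (r := ((⊤ : ℕ∞) : WithTop ℕ∞)) _ hτc
    (by simpa using WithTop.coe_le_coe.2 (le_top (a := (2 : ℕ∞))))]
  · ext w
    rw [inChart_apply, symmDeriv_eq_comp hy hxs]
    change ofChart x _ _ = _
    rw [ofChart_eq, ← hx, symmDeriv_self]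
    rfl
  · exact differentiableAt_of_contDiffOn (isOpen_extChartAt_target x) (hα x)
      (mem_extChartAt_target x)

end Charts

end FormField

/-! ### Cartan calculus on the manifold -/

namespace FormField

section Calculus

open ContinuousAlternatingMap VectorField

variable {E : Type*} [NormedAddCommGroup E] [NormedSpace ℝ E]
  {M : Type*} [TopologicalSpace M] [ChartedSpace E M]
  {k : ℕ}

theorem map_vecCons_vecCons_swap (a : E [⋀^Fin (k + 2)]→L[ℝ] ℝ) (u v : E) (w : Fin k → E) :
    a (Matrix.vecCons u (Matrix.vecCons v w)) = -a (Matrix.vecCons v (Matrix.vecCons u w)) := by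
  refine Eq.trans (congrArg a (funext fun i => ?_)) (a.toAlternatingMap.map_swap
    (Matrix.vecCons v (Matrix.vecCons u w)) (i := 0) (j := 1) (by simp))
  refine Fin.cases ?_ (fun i => Fin.cases ?_ (fun i => ?_) i) i
  · simp
  · simp
  · simp [Equiv.swap_apply_def, Fin.ext_iff]

theorem contract_contract (V W : ∀ x : M, TangentSpace 𝓘(ℝ, E) x) (α : FormField E M (k + 2)) :
    contract V (contract W α) = -contract W (contract V α) :=
  funext fun x => ContinuousAlternatingMap.ext fun w =>
    map_vecCons_vecCons_swap (E := E) (α x) (W x) (V x) w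

theorem contract_zero (V : ∀ x : M, TangentSpace 𝓘(ℝ, E) x) :
    contract V (0 : FormField E M (k + 1)) = 0 :=
  rfl

theorem IsSmooth.differentiableAt {α : FormField E M k} (hα : α.IsSmooth) (x₀ : M) :
    DifferentiableAt ℝ (inChart x₀ α) (extChartAt 𝓘(ℝ, E) x₀ x₀) :=
  differentiableAt_of_contDiffOn (isOpen_extChartAt_target x₀) (hα x₀) (mem_extChartAt_target x₀)

variable [IsManifold 𝓘(ℝ, E) ((⊤ : ℕ∞) : WithTop ℕ∞) M]

theorem d_apply (α : FormField E M k) (x : M) :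
    α.d x = extDeriv (inChart x α) (extChartAt 𝓘(ℝ, E) x x) :=
  ofChart_eq x _

theorem lieDeriv_apply (V : ∀ x : M, TangentSpace 𝓘(ℝ, E) x) (α : FormField E M k) (x : M) :
    α.lieDeriv V x = lieDerivModel (chartVF x V) (inChart x α) (extChartAt 𝓘(ℝ, E) x x) :=
  ofChart_eq x _

theorem eventuallyEq_inChart_d (x₀ : M) {α : FormField E M k} (hα : α.IsSmooth) :
    inChart x₀ α.d =ᶠ[nhds (extChartAt 𝓘(ℝ, E) x₀ x₀)] extDeriv (inChart x₀ α) := by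
  filter_upwards [(isOpen_extChartAt_target x₀).mem_nhds (mem_extChartAt_target x₀)] with y hy
  exact inChart_d hy hα

theorem eventuallyEq_inChart_contract (x₀ : M) (V : ∀ x : M, TangentSpace 𝓘(ℝ, E) x)
    (α : FormField E M (k + 1)) :
    inChart x₀ (contract V α) =ᶠ[nhds (extChartAt 𝓘(ℝ, E) x₀ x₀)]
      fun y => (inChart x₀ α y).curryLeft (chartVF x₀ V y) := by
  filter_upwards [(isOpen_extChartAt_target x₀).mem_nhds (mem_extChartAt_target x₀)] with y hy
  exact inChart_contract hy V α

theorem IsSmooth.d {α : FormField E M k} (hα : α.IsSmooth) : α.d.IsSmooth := fun x₀ =>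
  (contDiffOn_extDeriv (isOpen_extChartAt_target x₀) (hα x₀)).congr fun _ hy => inChart_d hy hα

theorem d_d {α : FormField E M k} (hα : α.IsSmooth) : α.d.d = 0 := by
  funext x
  rw [d_apply, (eventuallyEq_inChart_d x hα).extDeriv_eq]
  exact extDeriv_extDeriv_eq_zero_of_contDiffOn (isOpen_extChartAt_target x) (hα x)
    (mem_extChartAt_target x)

theorem d_add {α β : FormField E M k} (hα : α.IsSmooth) (hβ : β.IsSmooth) :
    (α + β).d = α.d + β.d := by
  funext x
  rw [Pi.add_apply, d_apply, d_apply, d_apply]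
  exact extDeriv_add (hα.differentiableAt x) (hβ.differentiableAt x)

/-- Cartan's formula in degree zero. -/
theorem lieDeriv_eq_contract_d (V : ∀ x : M, TangentSpace 𝓘(ℝ, E) x)
    {α : FormField E M 0} (hα : α.IsSmooth) :
    α.lieDeriv V = α.d.contract V := by
  funext x
  rw [lieDeriv_apply, lieDerivModel_zero_eq,
    ← inChart_d (mem_extChartAt_target x) hα, inChart_self, chartVF_self]
  rfl

theorem mlieBracket_eq_lieBracket_chartVF (V W : ∀ x : M, TangentSpace 𝓘(ℝ, E) x) (x : M) :
    mlieBracket 𝓘(ℝ, E) V W x =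
      lieBracket ℝ (chartVF x V) (chartVF x W) (extChartAt 𝓘(ℝ, E) x x) := by
  have : IsManifold 𝓘(ℝ, E) 1 M := .of_le (n := ((⊤ : ℕ∞) : WithTop ℕ∞)) (by simp)
  rw [mlieBracket, mlieBracketWithin_def]
  simp only [mpullback, mfderiv_extChartAt_self, ModelWithCorners.range_eq_univ,
    Set.preimage_univ, Set.univ_inter, mpullbackWithin_univ]
  change (ContinuousLinearMap.id ℝ E).inverse
    (lieBracketWithin ℝ (chartVF x V) (chartVF x W) Set.univ (extChartAt 𝓘(ℝ, E) x x)) = _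
  rw [ContinuousLinearMap.inverse_id, lieBracketWithin_univ]
  rfl

variable [CompleteSpace E]

/-- The pullback inverts the derivative of the inverse chart; completeness of `E` makes inversion
smooth near invertible maps. -/
theorem contDiffOn_chartVF (x₀ : M) (V : SmoothVectorField E M) :
    ContDiffOn ℝ ((⊤ : ℕ∞) : WithTop ℕ∞) (chartVF x₀ V) (extChartAt 𝓘(ℝ, E) x₀).target := by
  intro y hy
  refine ContDiffAt.contDiffWithinAt ?_
  refine (contMDiffAt_vectorSpace_iff_contDiffAt
    (V := mpullback 𝓘(ℝ, E) 𝓘(ℝ, E) (extChartAt 𝓘(ℝ, E) x₀).symm V)).1 ?_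
  refine ContMDiffAt.mpullback_vectorField_preimage (n := ((⊤ : ℕ∞) : WithTop ℕ∞))
    V.contMDiff.contMDiffAt ?_ (isInvertible_symmDeriv (E := E) hy) (by simp)
  exact (contMDiffOn_extChartAt_symm x₀).contMDiffAt ((isOpen_extChartAt_target x₀).mem_nhds hy)

variable (V W : SmoothVectorField E M)

theorem IsSmooth.contract {α : FormField E M (k + 1)} (hα : α.IsSmooth) :
    (α.contract V).IsSmooth := fun x₀ =>
  (contDiffOn_curryLeft (contDiffOn_chartVF x₀ V) (hα x₀)).congr
    fun _ hy => inChart_contract hy _ α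

theorem differentiableAt_chartVF (x₀ : M) :
    DifferentiableAt ℝ (chartVF x₀ V) (extChartAt 𝓘(ℝ, E) x₀ x₀) :=
  differentiableAt_of_contDiffOn (isOpen_extChartAt_target x₀) (contDiffOn_chartVF x₀ V)
    (mem_extChartAt_target x₀)

/-- Cartan's formula in positive degree. -/
theorem lieDeriv_eq_d_contract_add {α : FormField E M (k + 1)} (hα : α.IsSmooth) :
    α.lieDeriv V = (α.contract V).d + α.d.contract V := by
  funext x
  rw [Pi.add_apply, lieDeriv_apply, lieDerivModel_eq_extDeriv_add (differentiableAt_chartVF V x)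
    (hα.differentiableAt x), d_apply, (eventuallyEq_inChart_contract x _ α).extDeriv_eq,
    ← inChart_d (mem_extChartAt_target x) hα, inChart_self, chartVF_self]
  rfl

/-- The definition uses a different chart at each point, so smoothness is read off from Cartan's
formula instead. -/
theorem IsSmooth.lieDeriv {α : FormField E M k} (hα : α.IsSmooth) : (α.lieDeriv V).IsSmooth := by
  cases k with
  | zero =>
    rw [lieDeriv_eq_contract_d V hα]
    exact hα.d.contract V
  | succ k =>
    rw [lieDeriv_eq_d_contract_add V hα]
    exact (SmoothForm E M (k + 1)).add_mem (hα.contract V).d (hα.d.contract V)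

/-- The Lie derivative commutes with the exterior derivative. -/
theorem d_lieDeriv {α : FormField E M k} (hα : α.IsSmooth) :
    (α.lieDeriv V).d = α.d.lieDeriv V := by
  -- Both sides reduce to `d ι_V dα`.
  rw [lieDeriv_eq_d_contract_add V hα.d, d_d hα, contract_zero, add_zero]
  cases k with
  | zero => rw [lieDeriv_eq_contract_d V hα]
  | succ k =>
    rw [lieDeriv_eq_d_contract_add V hα, d_add (hα.contract V).d (hα.d.contract V),
      d_d (hα.contract V), zero_add]

/-- The commutator of a Lie derivative and a contraction. -/
theorem lieDeriv_contract {α : FormField E M (k + 1)} (hα : α.IsSmooth) :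
    (α.contract W).lieDeriv V =
      (α.lieDeriv V).contract W + α.contract (mlieBracket 𝓘(ℝ, E) V W) := by
  funext x
  rw [Pi.add_apply, lieDeriv_apply,
    (Filter.EventuallyEq.refl _ _).lieDerivModel_eq (eventuallyEq_inChart_contract x _ α),
    lieDerivModel_curryLeft (differentiableAt_chartVF W x) (hα.differentiableAt x),
    ← lieDeriv_apply, inChart_self, chartVF_self, ← mlieBracket_eq_lieBracket_chartVF]
  rfl

end Calculus

end FormField

/-! ### Linearity of `d` and of the Lie derivative, and degree casts -/

namespace FormField

open ContinuousAlternatingMap VectorField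

variable {E : Type*} [NormedAddCommGroup E] [NormedSpace ℝ E] {k : ℕ}

theorem lieDerivModel_add {V : E → E} {α β : E → E [⋀^Fin k]→L[ℝ] ℝ} {y : E}
    (hα : DifferentiableAt ℝ α y) (hβ : DifferentiableAt ℝ β y) :
    lieDerivModel V (α + β) y = lieDerivModel V α y + lieDerivModel V β y := by
  ext w
  simp only [lieDerivModel, fderiv_add hα hβ, ContinuousAlternatingMap.add_apply, Pi.add_apply,
    _root_.add_apply, fderivCompContinuousLinearMap_apply, Finset.sum_add_distrib]
  abel

theorem lieDerivModel_smul {V : E → E} {α : E → E [⋀^Fin k]→L[ℝ] ℝ} {y : E} (c : ℝ)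
    (hα : DifferentiableAt ℝ α y) :
    lieDerivModel V (c • α) y = c • lieDerivModel V α y := by
  ext w
  simp only [lieDerivModel, fderiv_const_smul hα, ContinuousAlternatingMap.add_apply,
    Pi.smul_apply, _root_.smul_apply, ContinuousAlternatingMap.smul_apply,
    fderivCompContinuousLinearMap_apply, ← Finset.smul_sum, smul_add]

theorem lieDerivModel_neg {V : E → E} {α : E → E [⋀^Fin k]→L[ℝ] ℝ} {y : E}
    (hα : DifferentiableAt ℝ α y) : lieDerivModel V (-α) y = -lieDerivModel V α y := by
  rw [← neg_one_smul ℝ α, lieDerivModel_smul _ hα]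
  exact neg_one_smul ℝ (lieDerivModel V α y)

variable {M : Type*} [TopologicalSpace M] [ChartedSpace E M]

theorem inChart_add (x₀ : M) (α β : FormField E M k) :
    inChart x₀ (α + β) = inChart x₀ α + inChart x₀ β :=
  rfl

theorem inChart_smul (x₀ : M) (c : ℝ) (α : FormField E M k) :
    inChart x₀ (c • α) = c • inChart x₀ α :=
  rfl

theorem inChart_neg (x₀ : M) (α : FormField E M k) : inChart x₀ (-α) = -inChart x₀ α :=
  rfl

theorem castDeg_castDeg {l : ℕ} (h : k = l) (h' : l = k) (α : FormField E M k) :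
    (α.castDeg h).castDeg h' = α := by
  subst h
  rfl

theorem castDeg_isSmooth {l : ℕ} (h : k = l) {α : FormField E M k} (hα : α.IsSmooth) :
    (α.castDeg h).IsSmooth := by
  subst h
  exact hα

theorem lieDeriv_castDeg_eq_zero {l : ℕ} (h : k = l) {V : ∀ x : M, TangentSpace 𝓘(ℝ, E) x}
    {α : FormField E M k} (hα : α.lieDeriv V = 0) : (α.castDeg h).lieDeriv V = 0 := by
  subst h
  exact hα

variable [IsManifold 𝓘(ℝ, E) ((⊤ : ℕ∞) : WithTop ℕ∞) M]

theorem d_neg (α : FormField E M k) : (-α).d = -α.d := by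
  funext x
  rw [Pi.neg_apply, d_apply, d_apply]
  rw [inChart_neg, ← neg_one_smul ℝ (inChart x α), extDeriv_smul, neg_one_smul]
  rfl

theorem d_smul (c : ℝ) (α : FormField E M k) : (c • α).d = c • α.d := by
  funext x
  rw [Pi.smul_apply, d_apply, d_apply]
  exact extDeriv_smul c (inChart x α)

theorem lieDeriv_add (V : ∀ x : M, TangentSpace 𝓘(ℝ, E) x) {α β : FormField E M k}
    (hα : α.IsSmooth) (hβ : β.IsSmooth) :
    (α + β).lieDeriv V = α.lieDeriv V + β.lieDeriv V := by
  funext x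
  rw [Pi.add_apply, lieDeriv_apply, lieDeriv_apply, lieDeriv_apply, inChart_add,
    lieDerivModel_add (hα.differentiableAt x) (hβ.differentiableAt x)]
  rfl

theorem lieDeriv_smul (V : ∀ x : M, TangentSpace 𝓘(ℝ, E) x) (c : ℝ) {α : FormField E M k}
    (hα : α.IsSmooth) : (c • α).lieDeriv V = c • α.lieDeriv V := by
  funext x
  rw [Pi.smul_apply, lieDeriv_apply, lieDeriv_apply, inChart_smul,
    lieDerivModel_smul c (hα.differentiableAt x)]
  rfl

theorem lieDeriv_neg (V : ∀ x : M, TangentSpace 𝓘(ℝ, E) x) {α : FormField E M k}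
    (hα : α.IsSmooth) : (-α).lieDeriv V = -α.lieDeriv V := by
  funext x
  rw [Pi.neg_apply, lieDeriv_apply, lieDeriv_apply, inChart_neg,
    lieDerivModel_neg (hα.differentiableAt x)]
  rfl

end FormField

/-! ### The conservation law on cycles -/

section Conservation

open FormField VectorField

variable {E : Type*} [NormedAddCommGroup E] [NormedSpace ℝ E]
  {M : Type*} [TopologicalSpace M] [ChartedSpace E M]
  [IsManifold 𝓘(ℝ, E) ((⊤ : ℕ∞) : WithTop ℕ∞) M]

variable (E M) in
/-- The exterior derivative as a linear map on smooth forms. -/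
def SmoothForm.dLinear (k : ℕ) : SmoothForm E M k →ₗ[ℝ] SmoothForm E M (k + 1) where
  toFun α := ⟨α.1.d, α.2.d⟩
  map_add' α β := Subtype.ext (d_add α.2 β.2)
  map_smul' c α := Subtype.ext (d_smul c α.1)

variable [CompleteSpace E]

/-- The Lie derivative as a linear map on smooth forms. -/
def SmoothForm.lieDerivLinear (V : SmoothVectorField E M) (k : ℕ) :
    SmoothForm E M k →ₗ[ℝ] SmoothForm E M k where
  toFun α := ⟨α.1.lieDeriv V, IsSmooth.lieDeriv V α.2⟩
  map_add' α β := Subtype.ext (lieDeriv_add V α.2 β.2)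
  map_smul' c α := Subtype.ext (lieDeriv_smul V c α.2)

theorem FormField.IsSmooth.contractMulti {j : ℕ} :
    ∀ (k : ℕ) (V : Fin k → SmoothVectorField E M) {α : FormField E M (j + k)}, α.IsSmooth →
      (FormField.contractMulti k (fun i => V i) α).IsSmooth
  | 0, _, _, hα => hα
  | k + 1, V, _, hα =>
    IsSmooth.contractMulti k (fun i => V i.succ) (IsSmooth.contract (k := j + k) (V 0) hα)

/-- If `L_U` kills `α` and all contractions with `[U, Vᵢ]` kill `α`, then `L_U` kills
`ι_{V_k} ⋯ ι_{V₁} α`. -/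
theorem lieDeriv_contractMulti_eq_zero (U : SmoothVectorField E M) {j : ℕ} :
    ∀ (k : ℕ) (V : Fin k → SmoothVectorField E M) (α : FormField E M (j + k)), α.IsSmooth →
      α.lieDeriv U = 0 →
      (∀ (l : ℕ) (h : j + k = l + 1) (i : Fin k),
        (α.castDeg h).contract (mlieBracket 𝓘(ℝ, E) U (V i)) = 0) →
      (contractMulti k (fun i => V i) α).lieDeriv U = 0
  | 0, _, _, _, h0, _ => h0
  | k + 1, V, α, hα, h0, hV => by
    refine lieDeriv_contractMulti_eq_zero U k (fun i => V i.succ) (α.contract (k := j + k) (V 0))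
      (IsSmooth.contract (k := j + k) (V 0) hα) ?_ ?_
    -- `L_U ι_{V₀} α = ι_{V₀} L_U α + ι_{[U,V₀]} α`, and both terms vanish.
    · rw [lieDeriv_contract (k := j + k) U (V 0) hα, h0, contract_zero, zero_add]
      exact hV _ rfl 0
    -- The bracket hypothesis passes to `ι_{V₀} α` because contractions anticommute. The index `i :
    -- Fin k` forces `k` to be positive, so the degrees are genuine successors and the cast
    -- disappears.
    · intro l h i
      obtain ⟨k, rfl⟩ : ∃ k', k = k' + 1 := ⟨k - 1, by have := i.2; omega⟩
      obtain rfl : l = j + k := by omega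
      change contract _ (contract (k := j + k + 1) _ α) = 0
      rw [contract_contract]
      have := hV _ rfl i.succ
      change contract (k := j + k + 1) _ α = 0 at this
      rw [this, contract_zero, neg_zero]

section

variable {m : ℕ} {ω : FormField E M (m + 2)} {H : FormField E M m} {U : SmoothVectorField E M}

/-- A Hamiltonian vector field preserves the multisymplectic form. -/
theorem IsHamiltonianVectorField.lieDeriv_eq_zero (hω : IsClosedForm ω) (hH : H.IsSmooth)
    (hU : IsHamiltonianVectorField ω H U) : ω.lieDeriv U = 0 := by
  have h : ω.contract U = -H.d := neg_eq_iff_eq_neg.1 hU.symm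
  -- Cartan: `L_U ω = d ι_U ω = -ddH`.
  rw [lieDeriv_eq_d_contract_add U hω.1, hω.2, contract_zero, add_zero, h, d_neg, d_d hH,
    neg_zero]

/-- If `V` preserves `ω` and locally preserves `H`, then `ι_{[V, U]} ω = 0` for every Hamiltonian
vector field `U` of `H`. -/
theorem IsHamiltonianVectorField.contract_mlieBracket_eq_zero (hω : ω.IsSmooth) (hH : H.IsSmooth)
    (hU : IsHamiltonianVectorField ω H U) {V : SmoothVectorField E M} (hV : ω.lieDeriv V = 0)
    (hVH : IsClosedForm (H.lieDeriv V)) :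
    ω.contract (mlieBracket 𝓘(ℝ, E) U V) = 0 := by
  have h : ω.contract U = -H.d := neg_eq_iff_eq_neg.1 hU.symm
  have h' := lieDeriv_contract V U hω
  -- Two evaluations of `L_V ι_U ω`: it is `-d L_V H = 0`, and it is `ι_{[V,U]} ω` since `L_V ω =
  -- 0`.
  rw [h, lieDeriv_neg _ hH.d, ← d_lieDeriv V hH, hVH.2, neg_zero, hV, contract_zero,
    zero_add] at h'
  rw [mlieBracket_swap]
  funext x
  have hx := congrFun h'.symm x
  change ContinuousAlternatingMap.curryLeft (E := E) (ω x) _ = 0 at hx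
  exact (map_neg (ContinuousAlternatingMap.curryLeft (E := E) (ω x)) _).trans
    (by rw [hx]; exact neg_zero)

end

/-- The values of a co-momentum map on cycles are locally conserved. -/
theorem IsCoMomentumMap.isLocallyConserved {𝔤 : Type*} [LieRing 𝔤] [LieAlgebra ℝ 𝔤] {m : ℕ}
    {ω : FormField E M (m + 2)} {H : FormField E M m} {v : 𝔤 →ₗ[ℝ] SmoothVectorField E M}
    {f : MomentumComponents E M 𝔤 (m + 1)} (hf : IsCoMomentumMap ω v f) (hω : IsClosedForm ω)
    (hH : H.IsSmooth) (hv : IsMultisymplecticAction ω v) (hvH : IsLocallyPreserving H v)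
    {U : SmoothVectorField E M} (hU : IsHamiltonianVectorField ω H U) (k j : ℕ)
    (h : k + 1 + j = m + 1) {p : ⋀[ℝ]^(k + 1) 𝔤} (hp : p ∈ lieCycles 𝔤 k) :
    IsLocallyConserved U (f (k + 1) j h p : FormField E M j) := by
  -- A cycle need not be decomposable, whereas the structure equation speaks of generators. Keeping
  -- the boundary term makes `T` linear on all of `Λ^{k+1} 𝔤`, so `L_U ∘ T = 0` can be checked on
  -- generators and only then restricted to cycles.
  let T : ⋀[ℝ]^(k + 1) 𝔤 →ₗ[ℝ] SmoothForm E M (j + 1) :=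
    SmoothForm.dLinear E M j ∘ₗ f (k + 1) j h + f k (j + 1) (by omega) ∘ₗ lieBoundary 𝔤 k
  have hT : SmoothForm.lieDerivLinear U (j + 1) ∘ₗ T = 0 := by
    refine LinearMap.ext_on_range (exteriorPower.ιMulti_span ℝ (k + 1) 𝔤) fun x => ?_
    apply Subtype.ext
    change FormField.lieDeriv U ((f (k + 1) j h _).1.d + (f k (j + 1) _ _).1) = 0
    have hdeg : m + 2 = j + 1 + (k + 1) := by omega
    have hs := hf.structure_eq k j h x
    have hz : (contractMulti (j := j + 1) (k + 1) (fun i => v (x i))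
        (ω.castDeg hdeg)).lieDeriv U = 0 := by
      refine lieDeriv_contractMulti_eq_zero U (k + 1) (fun i => v (x i)) _
        (castDeg_isSmooth hdeg hω.1) ?_ ?_
      · exact lieDeriv_castDeg_eq_zero hdeg (hU.lieDeriv_eq_zero hω hH)
      · intro l hl i
        obtain rfl : l = m + 1 := by omega
        rw [castDeg_castDeg]
        exact hU.contract_mlieBracket_eq_zero hω.1 hH (hv (x i)) (hvH (x i))
    have hC := IsSmooth.contractMulti (j := j + 1) (k + 1) (fun i => v (x i))
      (castDeg_isSmooth hdeg hω.1)
    have hsum : (f (k + 1) j h (exteriorPower.ιMulti ℝ (k + 1) x)).1.d +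
        (f k (j + 1) (by omega) (lieBoundary 𝔤 k (exteriorPower.ιMulti ℝ (k + 1) x))).1 =
          -(multiSign (k + 1) • contractMulti (j := j + 1) (k + 1) (fun i => v (x i))
            (ω.castDeg hdeg)) := by
      rw [eq_neg_iff_add_eq_zero, add_right_comm, ← hs, neg_add_cancel]
    exact (congrArg (FormField.lieDeriv U) hsum).trans <| by
      rw [lieDeriv_neg _ ((SmoothForm E M (j + 1)).smul_mem _ hC), lieDeriv_smul _ _ hC, hz,
        smul_zero, neg_zero]
  have hc : lieBoundary 𝔤 k p = 0 := hp
  have hTp : ((f (k + 1) j h p).1.d).lieDeriv U = 0 := by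
    have h0 := congrArg Subtype.val (LinearMap.congr_fun hT p)
    change FormField.lieDeriv U ((f (k + 1) j h p).1.d +
      (f k (j + 1) _ (lieBoundary 𝔤 k p)).1) = 0 at h0
    rw [hc, map_zero] at h0
    exact (congrArg (FormField.lieDeriv U) (add_zero _)).symm.trans h0
  exact ⟨IsSmooth.lieDeriv U (f (k + 1) j h p).2, (d_lieDeriv U (f (k + 1) j h p).2).trans hTp⟩

end Conservation

/-- Every term of the boundary carries a bracket, hence `0`, in its first slot. In the example this
makes `a ∧ b` a cycle and removes the left-hand sides of the structure equations. -/
theorem lieBoundary_eq_zero_of_isLieAbelian (𝔞 : Type*) [LieRing 𝔞] [LieAlgebra ℝ 𝔞]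
    [IsLieAbelian 𝔞] (k : ℕ) : lieBoundary 𝔞 k = 0 := by
  cases k with
  | zero => rfl
  | succ k =>
    refine LinearMap.ext_on_range (exteriorPower.ιMulti_span ℝ (k + 2) 𝔞) fun x => ?_
    refine (exteriorPower.alternatingMapLinearEquiv_apply_ιMulti _ _).trans ?_
    change lieBoundaryFun 𝔞 k x = 0
    rw [lieBoundaryFun]
    refine Finset.sum_eq_zero fun i _ => Finset.sum_eq_zero fun j _ => ?_
    rw [trivial_lie_zero]
    exact (congrArg _ ((exteriorPower.ιMulti ℝ (k + 1)).map_coord_zero 0 rfl)).trans (smul_zero _)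

/-! ### Forms with linear or constant coefficients on a vector space -/

section VectorSpace

open FormField ContinuousAlternatingMap

variable {E : Type*} [NormedAddCommGroup E] [NormedSpace ℝ E] {k : ℕ}

namespace FormField

theorem symmDeriv_vectorSpace (x₀ y : E) : symmDeriv x₀ y = ContinuousLinearMap.id ℝ E := by
  rw [symmDeriv, extChartAt_model_space_eq_id]
  exact mfderiv_id

theorem inChart_vectorSpace (x₀ : E) (α : FormField E E k) (y : E) : inChart x₀ α y = α y := by
  ext w
  rw [inChart_apply, symmDeriv_vectorSpace, extChartAt_model_space_eq_id]
  rfl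

theorem chartVF_vectorSpace (x₀ : E) (V : ∀ x : E, TangentSpace 𝓘(ℝ, E) x) (y : E) :
    chartVF x₀ V y = V y := by
  change (symmDeriv x₀ y).inverse (V ((extChartAt 𝓘(ℝ, E) x₀).symm y)) = V y
  rw [symmDeriv_vectorSpace, ContinuousLinearMap.inverse_id, extChartAt_model_space_eq_id]
  rfl

theorem isSmooth_of_contDiff {α : E → E [⋀^Fin k]→L[ℝ] ℝ}
    (hα : ContDiff ℝ ((⊤ : ℕ∞) : WithTop ℕ∞) α) : IsSmooth (E := E) (M := E) α := fun x₀ =>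
  hα.contDiffOn.congr fun y _ => inChart_vectorSpace x₀ α y

theorem d_vectorSpace (α : E → E [⋀^Fin k]→L[ℝ] ℝ) (z : E) :
    d (E := E) (M := E) α z = extDeriv α z := by
  refine (d_apply (E := E) (M := E) α z).trans ?_
  have h : inChart (M := E) z α = α := funext (inChart_vectorSpace z α)
  rw [h, extChartAt_model_space_eq_id]
  rfl

theorem lieDeriv_vectorSpace (V : E → E) (α : E → E [⋀^Fin k]→L[ℝ] ℝ) (z : E) :
    lieDeriv (E := E) (M := E) V α z = lieDerivModel V α z := by
  refine (lieDeriv_apply (E := E) (M := E) V α z).trans ?_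
  have h : inChart (M := E) z α = α := funext (inChart_vectorSpace z α)
  have h' : chartVF (M := E) z V = V := funext (chartVF_vectorSpace z V)
  rw [h, h', extChartAt_model_space_eq_id]
  rfl

end FormField

variable (E k) in
/-- Forms on a vector space with linear coefficients. -/
def linearForm : (E →L[ℝ] E [⋀^Fin k]→L[ℝ] ℝ) →ₗ[ℝ] SmoothForm E E k where
  toFun A := ⟨fun z => A z, isSmooth_of_contDiff A.contDiff⟩
  map_add' _ _ := rfl
  map_smul' _ _ := rfl

/-- Forms on a vector space with constant coefficients. -/
def constForm (a : E [⋀^Fin k]→L[ℝ] ℝ) : SmoothForm E E k :=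
  ⟨fun _ => a, isSmooth_of_contDiff contDiff_const⟩

variable (E) in
/-- Constant vector fields. -/
def constField : E →ₗ[ℝ] SmoothVectorField E E where
  toFun w := ⟨fun _ => w, contMDiff_vectorSpace_iff_contDiff.2 contDiff_const⟩
  map_add' _ _ := rfl
  map_smul' _ _ := rfl

/-- A continuous linear coefficient map is its own derivative, so `d` yields a constant form, the
alternatization of `A`. -/
theorem d_linearForm (A : E →L[ℝ] E [⋀^Fin k]→L[ℝ] ℝ) (z : E) :
    (linearForm E k A).1.d z = alternatizeUncurryFin A := by
  refine (d_vectorSpace (fun z => A z) z).trans ?_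
  rw [extDeriv, A.fderiv]

theorem d_constForm (a : E [⋀^Fin k]→L[ℝ] ℝ) : (constForm a).1.d = 0 := by
  funext z
  refine (d_vectorSpace (fun _ => a) z).trans ?_
  rw [extDeriv, fderiv_fun_const]
  exact map_zero (alternatizeUncurryFinCLM ℝ E ℝ)

theorem lieDeriv_linearForm (w : E) (A : E →L[ℝ] E [⋀^Fin k]→L[ℝ] ℝ) (z : E) :
    (linearForm E k A).1.lieDeriv (constField E w) z = A w := by
  refine (lieDeriv_vectorSpace (fun _ => w) (fun z => A z) z).trans ?_
  rw [lieDerivModel, A.fderiv, fderiv_fun_const, Pi.zero_apply, _root_.map_zero, add_zero]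

theorem lieDeriv_constForm (w : E) (a : E [⋀^Fin k]→L[ℝ] ℝ) :
    (constForm a).1.lieDeriv (constField E w) = 0 := by
  funext z
  refine (lieDeriv_vectorSpace (fun _ => w) (fun _ => a) z).trans ?_
  rw [lieDerivModel, fderiv_fun_const, fderiv_fun_const, Pi.zero_apply, Pi.zero_apply,
    _root_.map_zero, add_zero]
  rfl

theorem mlieBracket_constField (u w : E) :
    VectorField.mlieBracket 𝓘(ℝ, E) (constField E u) (constField E w) = 0 := by
  funext z
  rw [mlieBracket_eq_lieBracket_chartVF]
  have h (w : E) : chartVF (M := E) z (constField E w) = fun _ => w :=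
    funext (chartVF_vectorSpace z _)
  rw [h, h, VectorField.lieBracket, fderiv_fun_const, fderiv_fun_const]
  exact sub_zero _

end VectorSpace

/-! ### The example of translations on `ℝ³` -/

namespace TranslationExample

open FormField ContinuousAlternatingMap

/-- The volume form `dx ∧ dy ∧ dz`. -/
def volForm : R3 [⋀^Fin 3]→L[ℝ] ℝ :=
  { Matrix.detRowAlternating.compLinearMap (WithLp.linearEquiv 2 ℝ (Fin 3 → ℝ)).toLinearMap with
    cont := by
      change Continuous fun u : Fin 3 → R3 => Matrix.det (Matrix.of fun r s => u r s)
      refine Continuous.matrix_det (continuous_matrix fun r s => ?_)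
      exact (EuclideanSpace.proj (𝕜 := ℝ) s).continuous.comp (continuous_apply r) }

theorem volForm_apply (u : Fin 3 → R3) :
    volForm u = Matrix.det (Matrix.of fun r s => u r s) :=
  rfl

/-- The linear coefficient map of the one-form `zᵢ dzⱼ`. -/
def coordOneForm (i j : Fin 3) : R3 →L[ℝ] R3 [⋀^Fin 1]→L[ℝ] ℝ :=
  (EuclideanSpace.proj i : R3 →L[ℝ] ℝ).smulRight
    (ofSubsingleton ℝ R3 ℝ (0 : Fin 1) (EuclideanSpace.proj j))

theorem coordOneForm_apply (i j : Fin 3) (z : R3) (u : Fin 1 → R3) :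
    coordOneForm i j z u = z i * u 0 j :=
  rfl

/-- The linear coefficient map of the function `zᵢ`. -/
def coordFun (i : Fin 3) : R3 →L[ℝ] R3 [⋀^Fin 0]→L[ℝ] ℝ :=
  (EuclideanSpace.proj i : R3 →L[ℝ] ℝ).smulRight (constOfIsEmpty ℝ R3 (Fin 0) 1)

theorem coordFun_apply (i : Fin 3) (z : R3) (u : Fin 0 → R3) : coordFun i z u = z i :=
  mul_one (z i)

/-- The abelian Lie algebra of dimension two. -/
@[reducible]
def planeLieRing : LieRing (Fin 2 → ℝ) where
  bracket _ _ := 0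
  add_lie _ _ _ := (add_zero 0).symm
  lie_add _ _ _ := (add_zero 0).symm
  lie_self _ := rfl
  leibniz_lie _ _ _ := (add_zero 0).symm

attribute [local instance] planeLieRing

/-- The algebra structure of the abelian Lie algebra of dimension two. -/
@[reducible]
def planeLieAlgebra : LieAlgebra ℝ (Fin 2 → ℝ) where
  __ := (inferInstance : Module ℝ (Fin 2 → ℝ))
  lie_smul c _ _ := (smul_zero c).symm

attribute [local instance] planeLieAlgebra

theorem planeLieAbelian : IsLieAbelian (Fin 2 → ℝ) := ⟨fun _ _ => rfl⟩

attribute [local instance] planeLieAbelian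

/-- The linear map with `a ↦ ∂_x`, `b ↦ ∂_y`. -/
def direction : (Fin 2 → ℝ) →ₗ[ℝ] R3 :=
  (LinearMap.proj 0).smulRight (EuclideanSpace.single 0 1) +
    (LinearMap.proj 1).smulRight (EuclideanSpace.single 1 1)

/-- The action by translations in the directions `∂_x` and `∂_y`. -/
def action : (Fin 2 → ℝ) →ₗ[ℝ] SmoothVectorField R3 R3 := constField R3 ∘ₗ direction

theorem direction_apply (x : Fin 2 → ℝ) (i : Fin 3) : direction x i = ![x 0, x 1, 0] i := by
  fin_cases i <;> simp [direction]

/-- The coefficients of the first component of the co-momentum map. -/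
def momentumOneCoeff : (Fin 2 → ℝ) →ₗ[ℝ] R3 →L[ℝ] R3 [⋀^Fin 1]→L[ℝ] ℝ :=
  (LinearMap.proj 0).smulRight (-coordOneForm 1 2) +
    (LinearMap.proj 1).smulRight (coordOneForm 0 2)

theorem multiSign_one : multiSign 1 = 1 := by norm_num [multiSign]

theorem multiSign_two : multiSign 2 = 1 := by norm_num [multiSign]

/-- The co-momentum map. -/
def momentum : MomentumComponents R3 R3 (Fin 2 → ℝ) 2
  | 1, 1, _ => linearForm R3 1 ∘ₗ momentumOneCoeff ∘ₗ
      (exteriorPower.oneEquiv ℝ (Fin 2 → ℝ)).toLinearMap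
  -- The determinant induces the functional on `Λ²` with value `1` on `a ∧ b`.
  | 2, 0, _ => linearForm R3 0 ∘ₗ LinearMap.toSpanSingleton ℝ _ (-coordFun 2) ∘ₗ
      exteriorPower.alternatingMapLinearEquiv Matrix.detRowAlternating
  -- Since `k + j = 2`, this default concerns only `f₀`.
  | _, _, _ => 0

theorem momentum_one (x : Fin 1 → Fin 2 → ℝ) :
    momentum 1 1 rfl (exteriorPower.ιMulti ℝ 1 x) = linearForm R3 1 (momentumOneCoeff (x 0)) := by
  rw [← exteriorPower.oneEquiv_ιMulti (R := ℝ) x]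
  rfl

theorem momentum_two (x : Fin 2 → Fin 2 → ℝ) :
    momentum 2 0 rfl (exteriorPower.ιMulti ℝ 2 x) =
      linearForm R3 0 (Matrix.det (Matrix.of x) • -coordFun 2) := by
  have h := exteriorPower.alternatingMapLinearEquiv_apply_ιMulti (R := ℝ)
    (Matrix.detRowAlternating (R := ℝ) (n := Fin 2)) x
  exact congrArg (fun c : ℝ => linearForm R3 0 (c • -coordFun 2)) h

theorem momentumOneCoeff_apply (x : Fin 2 → ℝ) (z : R3) (u : Fin 1 → R3) :
    momentumOneCoeff x z u = x 0 * (-(z 1) * u 0 2) + x 1 * (z 0 * u 0 2) := by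
  simp [momentumOneCoeff, coordOneForm_apply]

/-- On the basis: `d(-y dz) = -dy ∧ dz = -ι_{∂_x} ω` and `d(x dz) = dx ∧ dz = -ι_{∂_y} ω`. -/
theorem d_momentumOneCoeff (x : Fin 2 → ℝ) (u : Fin 2 → R3) :
    alternatizeUncurryFin (momentumOneCoeff x) u =
      -volForm (Matrix.vecCons (direction x) u) := by
  rw [volForm_apply, Matrix.det_fin_three, alternatizeUncurryFin_apply, Fin.sum_univ_two]
  simp [momentumOneCoeff_apply, direction_apply, Fin.removeNth, Fin.tail]
  ring

/-- On `a ∧ b` this is `d(-z) + ι_{∂_y} ι_{∂_x} ω = -dz + dz`; the factor `1` is `ς(2)`. -/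
theorem d_momentumTwoCoeff (x : Fin 2 → Fin 2 → ℝ) (u : Fin 1 → R3) :
    alternatizeUncurryFin (Matrix.det (Matrix.of x) • -coordFun 2) u +
      1 * volForm (Matrix.vecCons (direction (x 0)) (Matrix.vecCons (direction (x 1)) u)) = 0 := by
  rw [alternatizeUncurryFin_apply, volForm_apply, Matrix.det_fin_three, Matrix.det_fin_two]
  simp [direction_apply, coordFun_apply]
  ring

theorem isHamiltonian_momentum (x : Fin 2 → ℝ) :
    IsHamiltonianVectorField (m := 1) (constForm volForm).1
      (linearForm R3 1 (momentumOneCoeff x)).1 (action x) := by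
  funext z
  refine (d_linearForm _ z).trans (ContinuousAlternatingMap.ext fun u => ?_)
  exact d_momentumOneCoeff x u

theorem isCoMomentumMap : IsCoMomentumMap (m := 1) (constForm volForm).1 action momentum where
  zero_component := rfl
  hamiltonian x := ⟨action (exteriorPower.oneEquiv ℝ _ x), isHamiltonian_momentum _⟩
  momentum x := by
    rw [momentum_one]
    exact isHamiltonian_momentum x
  structure_eq k j h x := by
    rw [lieBoundary_eq_zero_of_isLieAbelian, LinearMap.zero_apply, _root_.map_zero]
    obtain ⟨rfl, rfl⟩ | ⟨rfl, rfl⟩ : k = 0 ∧ j = 1 ∨ k = 1 ∧ j = 0 := by omega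
    · rw [momentum_one, isHamiltonian_momentum (x 0), multiSign_one]
      funext z
      refine ContinuousAlternatingMap.ext fun u => ?_
      change -(0 : ℝ) = -volForm (Matrix.vecCons (direction (x 0)) u) +
        1 * volForm (Matrix.vecCons (direction (x 0)) u)
      ring
    · rw [momentum_two, multiSign_two]
      funext z
      refine ContinuousAlternatingMap.ext fun u => ?_
      refine Eq.trans ?_ (congrArg (· + 1 * volForm (Matrix.vecCons (direction (x 0))
        (Matrix.vecCons (direction (x 1)) u)))
          (congrArg (fun a : R3 [⋀^Fin 1]→L[ℝ] ℝ => a u) (d_linearForm _ z)).symm)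
      exact neg_zero.trans (d_momentumTwoCoeff x u).symm
  structure_eq_top x := by
    rw [lieBoundary_eq_zero_of_isLieAbelian, LinearMap.zero_apply, _root_.map_zero]
    funext z
    refine ContinuousAlternatingMap.ext fun u => ?_
    change -(0 : ℝ) = multiSign 3 * volForm (Matrix.vecCons (direction (x 0))
      (Matrix.vecCons (direction (x 1)) (Matrix.vecCons (direction (x 2)) u)))
    -- The three directions lie in the plane spanned by `∂_x` and `∂_y`, so the last column of the
    -- matrix vanishes.
    rw [volForm_apply, Matrix.det_fin_three]
    simp [direction_apply]

/-- `d(-x dy) = -dx ∧ dy = -ι_{∂_z} ω`. -/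
theorem isHamiltonian_linear : IsHamiltonianVectorField (m := 1) (constForm volForm).1
    (linearForm R3 1 (-coordOneForm 0 1)).1 (constField R3 (EuclideanSpace.single 2 1)) := by
  funext z
  refine (d_linearForm _ z).trans (ContinuousAlternatingMap.ext fun u => ?_)
  change alternatizeUncurryFin (-coordOneForm 0 1) u =
    -volForm (Matrix.vecCons (EuclideanSpace.single 2 1) u)
  rw [volForm_apply, Matrix.det_fin_three, alternatizeUncurryFin_apply, Fin.sum_univ_two]
  simp [coordOneForm_apply, Fin.removeNth, Fin.tail]
  ring

theorem isGloballyPreserving :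
    IsGloballyPreserving (linearForm R3 1 (-coordOneForm 0 1)).1 action := by
  intro x
  -- For the action of `x = (x₀, x₁)`, the Lie derivative of `-x dy` is `-x₀ dy = d(-x₀ y)`.
  refine ⟨linearForm R3 0 (x 0 • -coordFun 1), ?_⟩
  funext z
  refine (d_linearForm _ z).trans (Eq.trans ?_ (lieDeriv_linearForm (direction x) _ z).symm)
  ext u
  rw [alternatizeUncurryFin_apply]
  simp [coordFun_apply, coordOneForm_apply, direction_apply]

theorem isLocallyPreserving :
    IsLocallyPreserving (linearForm R3 1 (-coordOneForm 0 1)).1 action := fun x =>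
  ⟨IsSmooth.lieDeriv (action x) (linearForm R3 1 (-coordOneForm 0 1)).2, by
    obtain ⟨β, hβ⟩ := isGloballyPreserving x
    rw [← hβ]
    exact d_d β.2⟩

theorem lieDeriv_momentum_two (z : R3) (u : Fin 0 → R3) :
    FormField.lieDeriv (constField R3 (EuclideanSpace.single 2 1))
      (momentum 2 0 rfl (exteriorPower.ιMulti ℝ 2
        ![Pi.basisFun ℝ (Fin 2) 0, Pi.basisFun ℝ (Fin 2) 1])).1 z u = -1 := by
  rw [momentum_two, lieDeriv_linearForm]
  change (Matrix.det _ • -coordFun 2) (EuclideanSpace.single 2 1) u = -1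
  rw [Matrix.det_fin_two]
  simp [coordFun_apply]

end TranslationExample

end

/-! ### Assembly of the conservation law and the counterexample -/

open TranslationExample in
theorem mainTheorem2 :
    -- the conservation law, for `n = m + 1` and degrees `1 ≤ k + 1 ≤ n`, `j = n - (k + 1)`
    (∀ (E : Type*) [NormedAddCommGroup E] [NormedSpace ℝ E] [FiniteDimensional ℝ E]
      (M : Type*) [TopologicalSpace M] [ChartedSpace E M]
      [IsManifold 𝓘(ℝ, E) ((⊤ : ℕ∞) : WithTop ℕ∞) M]
      (𝔤 : Type*) [LieRing 𝔤] [LieAlgebra ℝ 𝔤] (m : ℕ)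
      (ω : SmoothForm E M (m + 2)) (H : SmoothForm E M m)
      (v : 𝔤 →ₗ[ℝ] SmoothVectorField E M) (f : MomentumComponents E M 𝔤 (m + 1)),
      IsClosedForm (ω : FormField E M (m + 2)) →
      IsInfinitesimalAction v →
      IsMultisymplecticAction (ω : FormField E M (m + 2)) v →
      IsLocallyPreserving (H : FormField E M m) v →
      IsCoMomentumMap (ω : FormField E M (m + 2)) v f →
      ∀ vH : SmoothVectorField E M,
        IsHamiltonianVectorField (ω : FormField E M (m + 2)) (H : FormField E M m) vH →
        ∀ (k j : ℕ) (h : k + 1 + j = m + 1), ∀ p ∈ lieCycles 𝔤 k,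
          IsLocallyConserved vH (f (k + 1) j h p : FormField E M j)) ∧
    -- the example: `M = ℝ³`, `ω = dx ∧ dy ∧ dz`, `H = -x dy`, `v_H = ∂_z`, and the abelian Lie
    -- algebra with basis `a = e 0`, `b = e 1` acting by `v_a = ∂_x`, `v_b = ∂_y`
    (∃ (𝔞 : Type) (_ : LieRing 𝔞) (_ : LieAlgebra ℝ 𝔞) (_ : IsLieAbelian 𝔞)
      (e : Module.Basis (Fin 2) ℝ 𝔞)
      (ω : SmoothForm R3 R3 3) (H : SmoothForm R3 R3 1) (vH : SmoothVectorField R3 R3)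
      (v : 𝔞 →ₗ[ℝ] SmoothVectorField R3 R3) (f : MomentumComponents R3 R3 𝔞 2),
      (∀ (z : R3) (u : Fin 3 → R3), ω.1 z u = Matrix.det (Matrix.of fun r s => u r s)) ∧
      (∀ (z : R3) (u : Fin 1 → R3), H.1 z u = -(z 0) * u 0 1) ∧
      (∀ z : R3, vH z = EuclideanSpace.single (2 : Fin 3) (1 : ℝ)) ∧
      (∀ z : R3, v (e 0) z = EuclideanSpace.single (0 : Fin 3) (1 : ℝ)) ∧
      (∀ z : R3, v (e 1) z = EuclideanSpace.single (1 : Fin 3) (1 : ℝ)) ∧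
      IsClosedForm ω.1 ∧
      IsHamiltonianVectorField (m := 1) ω.1 H.1 vH ∧
      IsInfinitesimalAction v ∧
      IsMultisymplecticAction (m := 1) ω.1 v ∧
      IsLocallyPreserving H.1 v ∧
      IsGloballyPreserving H.1 v ∧
      IsCoMomentumMap (m := 1) ω.1 v f ∧
      -- `f₁(a) = -y dz`, `f₁(b) = x dz`, `f₂(a ∧ b) = -z`
      (∀ (z : R3) (u : Fin 1 → R3),
        (f 1 1 rfl (exteriorPower.ιMulti ℝ 1 ![e 0])).1 z u = -(z 1) * u 0 2) ∧
      (∀ (z : R3) (u : Fin 1 → R3),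
        (f 1 1 rfl (exteriorPower.ιMulti ℝ 1 ![e 1])).1 z u = z 0 * u 0 2) ∧
      (∀ (z : R3) (u : Fin 0 → R3),
        (f 2 0 rfl (exteriorPower.ιMulti ℝ 2 ![e 0, e 1])).1 z u = -(z 2)) ∧
      -- `a ∧ b` is a cycle, `L_{v_H} f₂(a ∧ b) = -1`, and `f₂(a ∧ b)` is not globally conserved
      exteriorPower.ιMulti ℝ 2 ![e 0, e 1] ∈ lieCycles 𝔞 1 ∧
      (∀ (z : R3) (u : Fin 0 → R3),
        FormField.lieDeriv vH (f 2 0 rfl (exteriorPower.ιMulti ℝ 2 ![e 0, e 1])).1 z u = -1) ∧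
      ¬ IsGloballyConserved vH (f 2 0 rfl (exteriorPower.ιMulti ℝ 2 ![e 0, e 1])).1) := by
  refine ⟨?_, Fin 2 → ℝ, planeLieRing, planeLieAlgebra, planeLieAbelian, Pi.basisFun ℝ (Fin 2),
    constForm volForm, linearForm R3 1 (-coordOneForm 0 1),
    constField R3 (EuclideanSpace.single 2 1), action, momentum, ?_, ?_, ?_, ?_, ?_, ?_,
    isHamiltonian_linear, ?_, ?_, isLocallyPreserving, isGloballyPreserving, isCoMomentumMap,
    ?_, ?_, ?_, ?_, lieDeriv_momentum_two, ?_⟩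
  · intro E _ _ _ M _ _ _ 𝔤 _ _ m ω H v f hω _ hv hvH hf U hU k j h p hp
    have : CompleteSpace E := FiniteDimensional.complete ℝ E
    exact hf.isLocallyConserved hω H.2 hv hvH hU k j h hp
  · exact fun _ u => volForm_apply u
  · exact fun z u => (neg_mul (z 0) (u 0 1)).symm
  · exact fun _ => rfl
  · intro z
    change direction (Pi.basisFun ℝ (Fin 2) 0) = _
    simp [direction]
  · intro z
    change direction (Pi.basisFun ℝ (Fin 2) 1) = _
    simp [direction]
  · exact ⟨(constForm volForm).2, d_constForm volForm⟩
  · intro x y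
    -- Both sides are zero: the Lie algebra is abelian and constant fields commute.
    refine Eq.trans ?_ (mlieBracket_constField (direction x) (direction y)).symm
    exact congrArg DFunLike.coe (map_zero action)
  · exact fun x => lieDeriv_constForm (direction x) volForm
  · intro z u
    rw [momentum_one]
    exact (momentumOneCoeff_apply _ z u).trans (by simp)
  · intro z u
    rw [momentum_one]
    exact (momentumOneCoeff_apply _ z u).trans (by simp)
  · intro z u
    rw [momentum_two]
    change (Matrix.det _ • -coordFun 2) z u = -(z 2)
    rw [Matrix.det_fin_two]
    simp [coordFun_apply]
  · exact LinearMap.congr_fun (@lieBoundary_eq_zero_of_isLieAbelian _ planeLieRing planeLieAlgebra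
      planeLieAbelian 1) _
  · intro h
    -- Exactness in degree `0` means vanishing by definition, which contradicts the value `-1` at
    -- the origin.
    have h0 : FormField.lieDeriv (constField R3 (EuclideanSpace.single 2 1))
        (momentum 2 0 rfl (exteriorPower.ιMulti ℝ 2
          ![Pi.basisFun ℝ (Fin 2) 0, Pi.basisFun ℝ (Fin 2) 1])).1 = 0 := h
    have h1 : (0 : ℝ) = -1 := (congrArg (fun α : FormField R3 R3 0 => α 0 ![]) h0).symm.trans
      (lieDeriv_momentum_two 0 ![])
    norm_num at h1
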